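/- For $w,h>0$ consider the closed axis-parallel rectangle $w\times h$ (width $w$, height $h$), and let $\mathcal F_0=\{6\times 1,\;1\times 6,\;3\times 3\}$. A set $P\subset\mathbb R^2$ is \emph{$\mathcal F_0$-piercing} if it meets every translate of every rectangle in $\mathcal F_0$. The density of $P$ is $\limsup_{r\to\infty}|P\cap D_r|/\mathrm{Area}(D_r)$, where $D_r$ is the disc of radius $r$ centred at the origin. Let $\pi(\mathcal F_0)$ be the infimum of the densities of all $\mathcal F_0$-piercing sets, and $\pi_L(\mathcal F_0)$ the infimum of the densities of all $\mathcal F_0$-piercing lattices (lattices of rank $2$ in $\mathbb R^2$). Then: (1) every $\mathcal F_0$-piercing lattice has a fundamental parallelogram of area at most $\frac{31}{6}$; (2) there is a periodic $\mathcal F_0$-piercing set (one invariant under all translations of some lattice of rank $2$) that is not a translate of a lattice and whose density exists as a limit and equals $\frac16$; (3) consequently $\pi_L(\mathcal F_0)\ \ge\ \frac{36}{31}\,\pi(\mathcal F_0)$. -/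

import Mathlib

open scoped ENNReal

/-- The Euclidean plane. -/
abbrev Plane : Type := EuclideanSpace ℝ (Fin 2)

/-- The closed axis-parallel rectangle of width `w` and height `h` with lower left corner `p`;
as `p` varies these are all the translates of the `w × h` rectangle. -/
def rect (w h : ℝ) (p : Plane) : Set Plane :=
  {q | q 0 ∈ Set.Icc (p 0) (p 0 + w) ∧ q 1 ∈ Set.Icc (p 1) (p 1 + h)}

/-- `P` pierces every translate of every rectangle of the family `F`, where a pair `(w, h)` in `F`
stands for the `w × h` rectangle. -/
def Pierces (P : Set Plane) (F : Set (ℝ × ℝ)) : Prop :=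
  ∀ R ∈ F, ∀ p : Plane, (P ∩ rect R.1 R.2 p).Nonempty

/-- The density `|P ∩ D| / Area(D)` of `P` over a bounded domain `D`. -/
noncomputable def densityOver (P D : Set Plane) : ℝ≥0∞ :=
  ((P ∩ D).encard : ℝ≥0∞) / MeasureTheory.volume D

/-- The (upper) density of a point set: the upper limit of its densities over the discs of
radius `r` around the origin, as `r` tends to infinity. -/
noncomputable def upperDensity (P : Set Plane) : ℝ≥0∞ :=
  Filter.limsup (fun r : ℝ => densityOver P (Metric.ball 0 r)) Filter.atTop

/-- The density of `P` exists, as a limit, and is equal to `d`. -/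
def HasDensity (P : Set Plane) (d : ℝ≥0∞) : Prop :=
  Filter.Tendsto (fun r : ℝ => densityOver P (Metric.ball 0 r)) Filter.atTop (nhds d)

/-- `Λ` is a (rank two) point lattice in the plane. -/
def IsLattice (Λ : Submodule ℤ Plane) : Prop :=
  ∃ _ : DiscreteTopology Λ, IsZLattice ℝ Λ

/-- `P` is invariant under all the translations of some lattice. -/
def IsPeriodic (P : Set Plane) : Prop :=
  ∃ Λ : Submodule ℤ Plane, IsLattice Λ ∧ ∀ t ∈ Λ, ∀ p ∈ P, t + p ∈ P

/-- `P` is a translate of a lattice. -/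
def IsLatticeTranslate (P : Set Plane) : Prop :=
  ∃ (Λ : Submodule ℤ Plane) (t : Plane), IsLattice Λ ∧ P = (fun x => t + x) '' (Λ : Set Plane)

/-- `π(F)`: the lowest density of a point set that pierces all translates of the members
of `F`. -/
noncomputable def piercingDensity (F : Set (ℝ × ℝ)) : ℝ≥0∞ :=
  ⨅ (P : Set Plane) (_ : Pierces P F), upperDensity P

/-- `π_L(F)`: the lowest density of a lattice that pierces all translates of the members
of `F`. -/
noncomputable def latticePiercingDensity (F : Set (ℝ × ℝ)) : ℝ≥0∞ :=
  ⨅ (Λ : Submodule ℤ Plane) (_ : IsLattice Λ) (_ : Pierces (Λ : Set Plane) F),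
    upperDensity (Λ : Set Plane)

/-- The family consisting of the rectangles `6 × 1`, `1 × 6` and `3 × 3`. -/
def threeRects : Set (ℝ × ℝ) := {(6, 1), (1, 6), (3, 3)}

/-! Write a lattice basis as `(a, b)`, `(-c, d)` with `a, b, c, d ≥ 0`. Integer combinations of
these vectors miss the open box `(-c, a) × (0, b + d)`, so a piercing lattice has `a + c ≤ w` or `b
+ d ≤ h` for each `w × h` in the family. Replacing the basis vector with the larger horizontal
extent by the sum of the two gives another such basis, with a narrower and taller box; a subtraction
reverses the direction. A lattice thus yields a staircase of boxes, each constrained by all three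
rectangles.

For the area bound, choose among the boxes of height at most `3` one of minimal width. Outside the
degenerate case of a vertical basis vector, the next box is higher than `3`, hence of width at most
`3`. Walking a few steps both ways from this pair and applying the `6 × 1` and `1 × 6` constraints
bounds `a * d + b * c` by `31 / 6` (`area_le_of_straddle`, `area_le`). Every lattice has a suitable
basis because a generating pair of least total `ℓ¹` norm yields one
(`exists_isQuadrantBasis_of_minimal`).

The periodic set has the points `σ y + 6ℤ` in row `y`, where `σ` runs through `0, 2, 4, 1, 3, 5`.
Rows are pierced by construction, columns because `σ` permutes the residues, and squares because
cyclic gaps among three consecutive values of `σ` are at most `3`. All densities come from tilings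
(`hasDensity_of_tiling`). Finally `π ≤ 1/6` and `π_L ≥ 6/31` give the ratio. -/

/-- Supplies the products of slacks that turn quadratic bounds into linear certificates for
`linarith`. -/
theorem sub_mul_sub_nonneg {x y z w : ℝ} (h₁ : x ≤ y) (h₂ : z ≤ w) : 0 ≤ (y - x) * (w - z) :=
  mul_nonneg (sub_nonneg.2 h₁) (sub_nonneg.2 h₂)

/-! ### The area bound for staircases of empty boxes. -/

/-- A family of quadruples `(a, b, c, d)`, to be thought of as lattice bases `(a, b)`, `(-c, d)`
with one vector in each of the upper two quadrants. It is closed under the two reduction steps,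
and the empty box of size `(a + c) × (b + d)` attached to a basis contains none of the
rectangles `6 × 1`, `1 × 6` and `3 × 3`. -/
structure StaircaseFamily (Q : ℝ → ℝ → ℝ → ℝ → Prop) (A : ℝ) : Prop where
  nonneg : ∀ {a b c d}, Q a b c d → 0 ≤ a ∧ 0 ≤ b ∧ 0 ≤ c ∧ 0 ≤ d
  area : ∀ {a b c d}, Q a b c d → a * d + b * c = A
  area_pos : 0 < A
  fwd_left : ∀ {a b c d}, Q a b c d → a ≤ c → Q a b (c - a) (b + d)
  fwd_right : ∀ {a b c d}, Q a b c d → c ≤ a → Q (a - c) (b + d) c d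
  bwd_left : ∀ {a b c d}, Q a b c d → b ≤ d → Q a b (a + c) (d - b)
  bwd_right : ∀ {a b c d}, Q a b c d → d ≤ b → Q (a + c) (b - d) c d
  flat_or_le_six : ∀ {a b c d}, Q a b c d → b + d ≤ 1 ∨ a + c ≤ 6
  le_three : ∀ {a b c d}, Q a b c d → a + c ≤ 3 ∨ b + d ≤ 3
  thin_or_le_six : ∀ {a b c d}, Q a b c d → a + c ≤ 1 ∨ b + d ≤ 6
  finite : ∀ C : ℝ, {x : ℝ × ℝ × ℝ × ℝ | Q x.1 x.2.1 x.2.2.1 x.2.2.2 ∧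
    x.1 + x.2.2.1 ≤ C ∧ x.2.1 + x.2.2.2 ≤ C}.Finite

namespace StaircaseFamily

variable {Q : ℝ → ℝ → ℝ → ℝ → Prop} {A a b c d : ℝ}

/-- Reflection in the vertical axis; it permits assuming `a ≤ c`. -/
theorem swap (S : StaircaseFamily Q A) : StaircaseFamily (fun a b c d => Q c d a b) A where
  nonneg h := by have := S.nonneg h; tauto
  area h := by rw [← S.area h]; ring
  area_pos := S.area_pos
  fwd_left {a b c d} h hac := by simpa only [add_comm] using S.fwd_right h hac
  fwd_right {a b c d} h hac := by simpa only [add_comm] using S.fwd_left h hac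
  bwd_left {a b c d} h hac := by simpa only [add_comm] using S.bwd_right h hac
  bwd_right {a b c d} h hac := by simpa only [add_comm] using S.bwd_left h hac
  flat_or_le_six {a b c d} h := by simpa only [add_comm] using S.flat_or_le_six h
  le_three {a b c d} h := by simpa only [add_comm] using S.le_three h
  thin_or_le_six {a b c d} h := by simpa only [add_comm] using S.thin_or_le_six h
  finite C := by
    refine ((S.finite C).image fun x => (x.2.2.1, x.2.2.2, x.1, x.2.1)).subset ?_
    rintro ⟨a, b, c, d⟩ ⟨h, h₁, h₂⟩
    exact ⟨(c, d, a, b), ⟨h, by simpa only [add_comm] using h₁, by simpa only [add_comm] using h₂⟩,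
      rfl⟩

theorem fwd (S : StaircaseFamily Q A) (h : Q a b c d) :
    (a ≤ c ∧ Q a b (c - a) (b + d)) ∨ (c ≤ a ∧ Q (a - c) (b + d) c d) :=
  (le_total a c).imp (fun h' => ⟨h', S.fwd_left h h'⟩) fun h' => ⟨h', S.fwd_right h h'⟩

theorem bwd (S : StaircaseFamily Q A) (h : Q a b c d) :
    (b ≤ d ∧ Q a b (a + c) (d - b)) ∨ (d ≤ b ∧ Q (a + c) (b - d) c d) :=
  (le_total b d).imp (fun h' => ⟨h', S.bwd_left h h'⟩) fun h' => ⟨h', S.bwd_right h h'⟩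

/-- The area bound, for a basis whose box has height at most `3` while that of its successor is
higher than `3`. -/
theorem area_le_of_straddle (S : StaircaseFamily Q A) (g : Q a b c d) (hac : a ≤ c) (hc3 : c ≤ 3)
    (hH : b + d ≤ 3) (hH2 : 3 < 2 * b + d) : a * d + b * c ≤ 31 / 6 := by
  obtain ⟨ha, hb, hc, hd⟩ := S.nonneg g
  have f := S.fwd_left g hac
  -- The case tree moves `g` backward (flatter, wider boxes) and `f` forward (narrower, taller
  -- ones), at most four more steps in total. The `o`s record which basis vector is changed, the
  -- `r`s which side of the box obeys the rectangle constraint. Each leaf is a linear combination of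
  -- the listed products of slacks, or an outright contradiction.
  obtain ⟨o1, q⟩ | ⟨o1, q⟩ := S.bwd g
  · obtain r1 | r1 := S.flat_or_le_six q
    -- A predecessor of height at most `1` would give `b ≤ d ≤ 1`, against `3 < 2 * b + d`.
    · linarith
    · rename' q => g
      obtain ⟨o2, q⟩ | ⟨o2, q⟩ := S.fwd f
      · obtain r2 | r2 := S.thin_or_le_six q
        · linarith [sub_mul_sub_nonneg hc hH, sub_mul_sub_nonneg hc3 hH,
            sub_mul_sub_nonneg hc3 o1, sub_mul_sub_nonneg o2 hb, sub_mul_sub_nonneg o2 hd,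
            sub_mul_sub_nonneg r2 hb]
        · rename' q => f
          obtain ⟨o3, q⟩ | ⟨o3, q⟩ := S.bwd g
          · obtain r3 | r3 := S.flat_or_le_six q
            · rename' q => g
              obtain ⟨o4, q⟩ | ⟨o4, q⟩ := S.fwd f
              · obtain r4 | r4 := S.thin_or_le_six q
                · linarith [sub_mul_sub_nonneg ha r3, sub_mul_sub_nonneg hc hH,
                    sub_mul_sub_nonneg hc o3, sub_mul_sub_nonneg hac hH,
                    sub_mul_sub_nonneg hc3 hb, sub_mul_sub_nonneg hc3 hH,
                    sub_mul_sub_nonneg hc3 o1, sub_mul_sub_nonneg o4 hb]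
                · linarith [sub_mul_sub_nonneg ha r3, sub_mul_sub_nonneg hc hH,
                    sub_mul_sub_nonneg hc o3, sub_mul_sub_nonneg hac hH,
                    sub_mul_sub_nonneg hc3 hb, sub_mul_sub_nonneg hc3 hH,
                    sub_mul_sub_nonneg hc3 o1, sub_mul_sub_nonneg o4 hb]
              · obtain r4 | r4 := S.thin_or_le_six q
                · linarith [sub_mul_sub_nonneg ha r3, sub_mul_sub_nonneg hc hH,
                    sub_mul_sub_nonneg hc o3, sub_mul_sub_nonneg hac hH,
                    sub_mul_sub_nonneg hc3 hb, sub_mul_sub_nonneg hc3 hH,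
                    sub_mul_sub_nonneg hc3 o1, sub_mul_sub_nonneg r4 hb]
                · linarith
            · linarith [sub_mul_sub_nonneg hc hH, sub_mul_sub_nonneg hac o3,
                sub_mul_sub_nonneg hc3 hb, sub_mul_sub_nonneg hc3 hH, sub_mul_sub_nonneg r1 o3,
                sub_mul_sub_nonneg o2 o3, sub_mul_sub_nonneg r3 hb]
          · obtain r3 | r3 := S.flat_or_le_six q
            · rename' q => g
              obtain ⟨o4, q⟩ | ⟨o4, q⟩ := S.fwd f
              · obtain r4 | r4 := S.thin_or_le_six q
                · linarith [sub_mul_sub_nonneg ha o3, sub_mul_sub_nonneg hc r3,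
                    sub_mul_sub_nonneg hc3 hb, sub_mul_sub_nonneg hc3 hH,
                    sub_mul_sub_nonneg hc3 o1, sub_mul_sub_nonneg o4 hb]
                · linarith [sub_mul_sub_nonneg ha o3, sub_mul_sub_nonneg hc r3,
                    sub_mul_sub_nonneg hc3 hb, sub_mul_sub_nonneg hc3 hH,
                    sub_mul_sub_nonneg hc3 o1, sub_mul_sub_nonneg o4 hb]
              · obtain r4 | r4 := S.thin_or_le_six q
                · linarith [sub_mul_sub_nonneg ha o3, sub_mul_sub_nonneg hc r3,
                    sub_mul_sub_nonneg hc3 hb, sub_mul_sub_nonneg hc3 hH,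
                    sub_mul_sub_nonneg hc3 o1, sub_mul_sub_nonneg r4 hb]
                · linarith
            · linarith [sub_mul_sub_nonneg ha o3, sub_mul_sub_nonneg hc hH,
                sub_mul_sub_nonneg hac o1, sub_mul_sub_nonneg hc3 hH, sub_mul_sub_nonneg hc3 o1,
                sub_mul_sub_nonneg r3 hb]
      · obtain r2 | r2 := S.thin_or_le_six q
        · linarith [sub_mul_sub_nonneg hc hH, sub_mul_sub_nonneg hac o1,
            sub_mul_sub_nonneg hc3 hH, sub_mul_sub_nonneg r1 o1, sub_mul_sub_nonneg o2 hb,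
            sub_mul_sub_nonneg r2 hb, sub_mul_sub_nonneg r2 hd]
        · rename' q => f
          obtain ⟨o3, q⟩ | ⟨o3, q⟩ := S.bwd g
          · obtain r3 | r3 := S.flat_or_le_six q
            · rename' q => g
              obtain ⟨o4, q⟩ | ⟨o4, q⟩ := S.fwd f
              · obtain r4 | r4 := S.thin_or_le_six q
                · linarith [sub_mul_sub_nonneg hc r2, sub_mul_sub_nonneg hc3 r2,
                    sub_mul_sub_nonneg r1 hb, sub_mul_sub_nonneg r1 hd, sub_mul_sub_nonneg o4 o3]
                · linarith
              · obtain r4 | r4 := S.thin_or_le_six q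
                · linarith [sub_mul_sub_nonneg hc r2, sub_mul_sub_nonneg hac r2,
                    sub_mul_sub_nonneg hc3 r2, sub_mul_sub_nonneg r1 hb,
                    sub_mul_sub_nonneg r1 hd, sub_mul_sub_nonneg o4 r3, sub_mul_sub_nonneg r4 hb,
                    sub_mul_sub_nonneg r4 hd]
                · linarith
            · linarith [sub_mul_sub_nonneg hc r2, sub_mul_sub_nonneg hac o3,
                sub_mul_sub_nonneg hc3 hH, sub_mul_sub_nonneg r1 hb, sub_mul_sub_nonneg r3 hd]
          · obtain r3 | r3 := S.flat_or_le_six q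
            · rename' q => g
              obtain ⟨o4, q⟩ | ⟨o4, q⟩ := S.fwd f
              · obtain r4 | r4 := S.thin_or_le_six q
                · linarith [sub_mul_sub_nonneg ha r2, sub_mul_sub_nonneg hc r2,
                    sub_mul_sub_nonneg hac r3, sub_mul_sub_nonneg hc3 r2,
                    sub_mul_sub_nonneg r1 hb, sub_mul_sub_nonneg r1 hd, sub_mul_sub_nonneg o4 r3,
                    sub_mul_sub_nonneg r4 hb]
                · linarith
              · obtain r4 | r4 := S.thin_or_le_six q
                · linarith [sub_mul_sub_nonneg hc r2, sub_mul_sub_nonneg hc3 r2,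
                    sub_mul_sub_nonneg r1 hb, sub_mul_sub_nonneg r1 hd, sub_mul_sub_nonneg o4 o3]
                · linarith
            · linarith [sub_mul_sub_nonneg hc r2, sub_mul_sub_nonneg hac o1,
                sub_mul_sub_nonneg hc3 r2, sub_mul_sub_nonneg o2 o3, sub_mul_sub_nonneg r3 hb,
                sub_mul_sub_nonneg r3 hd]
  · obtain r1 | r1 := S.flat_or_le_six q
    · linarith
    · rename' q => g
      obtain ⟨o2, q⟩ | ⟨o2, q⟩ := S.bwd g
      · obtain r2 | r2 := S.flat_or_le_six q
        · rename' q => g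
          obtain ⟨o3, q⟩ | ⟨o3, q⟩ := S.fwd f
          · obtain r3 | r3 := S.thin_or_le_six q
            · linarith [sub_mul_sub_nonneg ha r2, sub_mul_sub_nonneg hc hH,
                sub_mul_sub_nonneg hc o2, sub_mul_sub_nonneg hac hH, sub_mul_sub_nonneg hc3 hH,
                sub_mul_sub_nonneg hc3 o2, sub_mul_sub_nonneg o3 hb, sub_mul_sub_nonneg r3 hb]
            · rename' q => f
              obtain ⟨o4, q⟩ | ⟨o4, q⟩ := S.fwd f
              · obtain r4 | r4 := S.thin_or_le_six q
                · linarith [sub_mul_sub_nonneg hc r3, sub_mul_sub_nonneg hc3 r3,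
                    sub_mul_sub_nonneg r1 hb, sub_mul_sub_nonneg r1 hd, sub_mul_sub_nonneg o4 o2]
                · linarith [sub_mul_sub_nonneg ha r2, sub_mul_sub_nonneg hc r4,
                    sub_mul_sub_nonneg hac r4, sub_mul_sub_nonneg hc3 r4,
                    sub_mul_sub_nonneg r1 hb, sub_mul_sub_nonneg r1 hd, sub_mul_sub_nonneg o4 hd,
                    sub_mul_sub_nonneg o4 o2]
              · obtain r4 | r4 := S.thin_or_le_six q
                · linarith [sub_mul_sub_nonneg hc r3, sub_mul_sub_nonneg hac r3,
                    sub_mul_sub_nonneg hc3 r3, sub_mul_sub_nonneg r1 hb,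
                    sub_mul_sub_nonneg r1 hd, sub_mul_sub_nonneg o4 r2, sub_mul_sub_nonneg r4 hb,
                    sub_mul_sub_nonneg r4 hd]
                · linarith
          · obtain r3 | r3 := S.thin_or_le_six q
            · linarith [sub_mul_sub_nonneg ha r2, sub_mul_sub_nonneg hc hH,
                sub_mul_sub_nonneg hc o2, sub_mul_sub_nonneg hac hH, sub_mul_sub_nonneg hc3 hH,
                sub_mul_sub_nonneg hc3 o2, sub_mul_sub_nonneg o3 hb, sub_mul_sub_nonneg r3 hb]
            · linarith [sub_mul_sub_nonneg ha r2, sub_mul_sub_nonneg hc r2,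
                sub_mul_sub_nonneg hc r3, sub_mul_sub_nonneg hac o2, sub_mul_sub_nonneg hac r3,
                sub_mul_sub_nonneg hc3 r3, sub_mul_sub_nonneg r1 hb, sub_mul_sub_nonneg r1 hd]
        · linarith [sub_mul_sub_nonneg ha o1, sub_mul_sub_nonneg hc hH,
            sub_mul_sub_nonneg hac o2, sub_mul_sub_nonneg hc3 hH, sub_mul_sub_nonneg r1 o2,
            sub_mul_sub_nonneg r2 hb]
      · obtain r2 | r2 := S.flat_or_le_six q
        · rename' q => g
          obtain ⟨o3, q⟩ | ⟨o3, q⟩ := S.fwd f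
          · obtain r3 | r3 := S.thin_or_le_six q
            · linarith [sub_mul_sub_nonneg ha o2, sub_mul_sub_nonneg hc hH,
                sub_mul_sub_nonneg hc r2, sub_mul_sub_nonneg hc3 hH, sub_mul_sub_nonneg hc3 r2,
                sub_mul_sub_nonneg o3 hb, sub_mul_sub_nonneg r3 hb]
            · rename' q => f
              obtain ⟨o4, q⟩ | ⟨o4, q⟩ := S.fwd f
              · obtain r4 | r4 := S.thin_or_le_six q
                · linarith [sub_mul_sub_nonneg ha r3, sub_mul_sub_nonneg hc r3,
                    sub_mul_sub_nonneg hc3 r3, sub_mul_sub_nonneg r1 hb,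
                    sub_mul_sub_nonneg r1 hd, sub_mul_sub_nonneg o3 r2, sub_mul_sub_nonneg o4 r2,
                    sub_mul_sub_nonneg r4 hb]
                · linarith [sub_mul_sub_nonneg ha o2, sub_mul_sub_nonneg ha r4,
                    sub_mul_sub_nonneg hc r4, sub_mul_sub_nonneg hac r2,
                    sub_mul_sub_nonneg hc3 r2, sub_mul_sub_nonneg hc3 r3,
                    sub_mul_sub_nonneg hc3 r4, sub_mul_sub_nonneg r1 hb]
              · obtain r4 | r4 := S.thin_or_le_six q
                · linarith [sub_mul_sub_nonneg hc r3, sub_mul_sub_nonneg hc3 r3,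
                    sub_mul_sub_nonneg r1 hb, sub_mul_sub_nonneg r1 hd, sub_mul_sub_nonneg o4 o2]
                · linarith
          · obtain r3 | r3 := S.thin_or_le_six q
            · linarith [sub_mul_sub_nonneg ha o2, sub_mul_sub_nonneg hc hH,
                sub_mul_sub_nonneg hc r2, sub_mul_sub_nonneg hc3 hH, sub_mul_sub_nonneg hc3 r2,
                sub_mul_sub_nonneg o3 hb, sub_mul_sub_nonneg r3 hb]
            · linarith [sub_mul_sub_nonneg ha r3, sub_mul_sub_nonneg hc r3,
                sub_mul_sub_nonneg hac r2, sub_mul_sub_nonneg hc3 r3, sub_mul_sub_nonneg r1 hb,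
                sub_mul_sub_nonneg r1 hd, sub_mul_sub_nonneg o3 o1, sub_mul_sub_nonneg o3 o2]
        · rename' q => g
          obtain ⟨o3, q⟩ | ⟨o3, q⟩ := S.bwd g
          · obtain r3 | r3 := S.flat_or_le_six q
            · linarith [sub_mul_sub_nonneg hc hH, sub_mul_sub_nonneg hac o3,
                sub_mul_sub_nonneg hc3 hH, sub_mul_sub_nonneg r2 hb, sub_mul_sub_nonneg r2 hd]
            · linarith [sub_mul_sub_nonneg ha o2, sub_mul_sub_nonneg hc hH,
                sub_mul_sub_nonneg hac o3, sub_mul_sub_nonneg hc3 hH, sub_mul_sub_nonneg r2 o3,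
                sub_mul_sub_nonneg r3 hb]
          · obtain r3 | r3 := S.flat_or_le_six q
            · linarith [sub_mul_sub_nonneg ha hb, sub_mul_sub_nonneg ha hH,
                sub_mul_sub_nonneg ha o3, sub_mul_sub_nonneg hc hH, sub_mul_sub_nonneg hac r3,
                sub_mul_sub_nonneg hc3 hH, sub_mul_sub_nonneg hc3 r3, sub_mul_sub_nonneg r2 hb]
            · linarith [sub_mul_sub_nonneg ha o2, sub_mul_sub_nonneg hc hH,
                sub_mul_sub_nonneg hac hd, sub_mul_sub_nonneg hc3 hd, sub_mul_sub_nonneg hc3 hH,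
                sub_mul_sub_nonneg r3 hb]

theorem iterate_fwd_left (S : StaircaseFamily Q A) (h : Q 0 b c d) (k : ℕ) :
    Q 0 b c (d + k * b) := by
  induction k with
  | zero => simpa using h
  | succ k ih =>
    have := S.fwd_left ih (S.nonneg ih).2.2.1
    convert this using 1 <;> push_cast <;> ring

theorem iterate_bwd_left (S : StaircaseFamily Q A) (h : Q a 0 c d) (k : ℕ) :
    Q a 0 (c + k * a) d := by
  induction k with
  | zero => simpa using h
  | succ k ih =>
    have := S.bwd_left ih (S.nonneg ih).2.2.2
    convert this using 1 <;> push_cast <;> ring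

/-- A vertical basis vector forces the other one to be short in the horizontal direction. -/
theorem le_one_of_vertical (S : StaircaseFamily Q A) (h : Q 0 b c d) : c ≤ 1 := by
  have hA := S.area h
  obtain ⟨-, hb, hc, hd⟩ := S.nonneg h
  have hb' : 0 < b := by
    rcases hb.eq_or_lt with rfl | hb'
    · have := S.area_pos; linarith
    · exact hb'
  -- After `k` forward steps the height exceeds `6` while the width is still `c`, so the `1 × 6`
  -- rectangle forces `c ≤ 1`.
  obtain ⟨k, hk⟩ := exists_nat_gt (6 / b)
  rw [div_lt_iff₀ hb'] at hk
  rcases S.thin_or_le_six (S.iterate_fwd_left h k) with h' | h' <;> linarith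

/-- A horizontal basis vector forces the other one to be short in the vertical direction. -/
theorem le_one_of_horizontal (S : StaircaseFamily Q A) (h : Q a 0 c d) : d ≤ 1 := by
  have hA := S.area h
  obtain ⟨ha, -, hc, hd⟩ := S.nonneg h
  have ha' : 0 < a := by
    rcases ha.eq_or_lt with rfl | ha'
    · have := S.area_pos; linarith
    · exact ha'
  obtain ⟨k, hk⟩ := exists_nat_gt (6 / a)
  rw [div_lt_iff₀ ha'] at hk
  rcases S.flat_or_le_six (S.iterate_bwd_left h k) with h' | h' <;> linarith

/-- Boxes of bounded size are finite in number, so a minimum exists once `P` and an upper bound on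
`f` together bound both sides of the box. -/
theorem exists_minimal (S : StaircaseFamily Q A) (P : ℝ → ℝ → Prop) (f : ℝ → ℝ → ℝ)
    (hf : ∀ t, ∃ C, ∀ W H, P W H → 0 ≤ W → 0 ≤ H → f W H ≤ t → W ≤ C ∧ H ≤ C)
    (h : Q a b c d) (hP : P (a + c) (b + d)) :
    ∃ a b c d, Q a b c d ∧ P (a + c) (b + d) ∧
      ∀ a' b' c' d', Q a' b' c' d' → P (a' + c') (b' + d') →
        f (a + c) (b + d) ≤ f (a' + c') (b' + d') := by
  obtain ⟨C, hC⟩ := hf (f (a + c) (b + d))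
  let s : Set (ℝ × ℝ × ℝ × ℝ) := {x | Q x.1 x.2.1 x.2.2.1 x.2.2.2 ∧
    P (x.1 + x.2.2.1) (x.2.1 + x.2.2.2) ∧
    f (x.1 + x.2.2.1) (x.2.1 + x.2.2.2) ≤ f (a + c) (b + d)}
  have hs : s.Finite := by
    refine (S.finite C).subset fun x hx => ⟨hx.1, ?_⟩
    obtain ⟨h₁, h₂, h₃, h₄⟩ := S.nonneg hx.1
    exact hC _ _ hx.2.1 (add_nonneg h₁ h₃) (add_nonneg h₂ h₄) hx.2.2
  obtain ⟨x, hx, hmin⟩ := Set.exists_min_image s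
    (fun x => f (x.1 + x.2.2.1) (x.2.1 + x.2.2.2)) hs ⟨(a, b, c, d), h, hP, le_rfl⟩
  refine ⟨x.1, x.2.1, x.2.2.1, x.2.2.2, hx.1, hx.2.1, fun a' b' c' d' h' hP' => ?_⟩
  by_cases hle : f (a' + c') (b' + d') ≤ f (a + c) (b + d)
  · exact hmin (a', b', c', d') ⟨h', hP', hle⟩
  · exact hx.2.2.trans (not_le.1 hle).le

/-- If all heights exceeded `3`, all widths would be at most `3` and a lowest box would exist. A
backward step cannot lower it only if one basis vector is horizontal, and then its height is at most
`1`. -/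
theorem exists_height_le_three (S : StaircaseFamily Q A) (h : Q a b c d) :
    ∃ a b c d, Q a b c d ∧ b + d ≤ 3 := by
  by_contra! hcon
  have hwide : ∀ {a b c d}, Q a b c d → a + c ≤ 3 := fun h' =>
    (S.le_three h').resolve_right (hcon _ _ _ _ h').not_ge
  obtain ⟨a, b, c, d, h, -, hmin⟩ := S.exists_minimal (fun W _ => W ≤ 3) (fun _ H => H)
    (fun t => ⟨max 3 t, fun W H h₁ _ _ h₂ => ⟨le_max_of_le_left h₁, le_max_of_le_right h₂⟩⟩)
    h (hwide h)
  have h3 := hcon _ _ _ _ h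
  obtain ⟨ha, hb, hc, hd⟩ := S.nonneg h
  obtain ⟨o, q⟩ | ⟨o, q⟩ := S.bwd h
  · have := hmin _ _ _ _ q (hwide q)
    obtain rfl : b = 0 := by linarith
    have := S.le_one_of_horizontal h
    linarith
  · have := hmin _ _ _ _ q (hwide q)
    obtain rfl : d = 0 := by linarith
    have := S.swap.le_one_of_horizontal h
    linarith

/-- The successor has width `c < a + c` unless `a = 0`, so minimality makes it higher than `3` and
the square then gives `c ≤ 3`. If `a = 0`, the area is `b * c` with `c ≤ 1` and `b ≤ 3`. -/
theorem area_le_of_minimal_width (S : StaircaseFamily Q A) (h : Q a b c d) (hH : b + d ≤ 3)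
    (hmin : ∀ a' b' c' d', Q a' b' c' d' → b' + d' ≤ 3 → a + c ≤ a' + c') (hac : a ≤ c) :
    A ≤ 31 / 6 := by
  rw [← S.area h]
  obtain ⟨ha, hb, hc, hd⟩ := S.nonneg h
  rcases ha.eq_or_lt with rfl | ha'
  · have := S.le_one_of_vertical h
    linarith [sub_mul_sub_nonneg hb this]
  · have q := S.fwd_left h hac
    have hH2 : 3 < b + (b + d) := by
      by_contra! hle
      have := hmin _ _ _ _ q hle
      linarith
    refine S.area_le_of_straddle h hac ?_ hH (by linarith)
    have := (S.le_three q).resolve_right hH2.not_ge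
    linarith

/-- The area bound for a nonempty staircase family. -/
theorem area_le (S : StaircaseFamily Q A) (h : Q a b c d) : A ≤ 31 / 6 := by
  obtain ⟨a, b, c, d, h, hH⟩ := S.exists_height_le_three h
  obtain ⟨a, b, c, d, h, hH, hmin⟩ := S.exists_minimal (fun _ H => H ≤ 3) (fun W _ => W)
    (fun t => ⟨max 3 t, fun W H h₁ _ _ h₂ => ⟨le_max_of_le_right h₂, le_max_of_le_left h₁⟩⟩)
    h hH
  rcases le_total a c with hac | hac
  · exact S.area_le_of_minimal_width h hH hmin hac
  · refine S.swap.area_le_of_minimal_width (a := c) (b := d) (c := a) (d := b) h (by linarith)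
      (fun a' b' c' d' h' hH' => ?_) hac
    have := hmin _ _ _ _ h' (by linarith)
    linarith

end StaircaseFamily

/-! ### Densities from tilings. -/

open MeasureTheory Filter Topology

theorem volume_ball_div_volume_ball {r s : ℝ} (hr : 0 < r) (hs : 0 ≤ s) :
    volume (Metric.ball (0 : Plane) s) / volume (Metric.ball (0 : Plane) r) =
      ENNReal.ofReal ((s / r) ^ 2) := by
  have hpi : (0 : ℝ) < r ^ 2 * Real.pi := by positivity
  rw [EuclideanSpace.volume_ball_fin_two, EuclideanSpace.volume_ball_fin_two,
    ← ENNReal.ofReal_pow hs, ← ENNReal.ofReal_pow hr.le, ← ENNReal.ofReal_mul (by positivity),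
    ← ENNReal.ofReal_mul (by positivity),
    ← ENNReal.ofReal_div_of_pos hpi]
  congr 1
  field_simp

theorem tendsto_ofReal_add_div_sq (R : ℝ) :
    Tendsto (fun r : ℝ => ENNReal.ofReal (((r + R) / r) ^ 2)) atTop (𝓝 1) := by
  have h : Tendsto (fun r : ℝ => (1 + R * r⁻¹) ^ 2) atTop (𝓝 ((1 + R * 0) ^ 2)) :=
    ((tendsto_inv_atTop_zero.const_mul R).const_add 1).pow 2
  have h' := ENNReal.tendsto_ofReal h
  simp only [mul_zero, add_zero, one_pow, ENNReal.ofReal_one] at h'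
  refine h'.congr' ?_
  filter_upwards [eventually_gt_atTop 0] with r hr
  congr 2
  field_simp

/-- If the translates `p + F`, `p ∈ P`, of a bounded set `F` tile the plane, then those with `p` in
the disc of radius `r` are packed into a slightly larger disc. -/
theorem encard_mul_volume_le {P F : Set Plane} {R r : ℝ} (hF : MeasurableSet F)
    (hR : ∀ x ∈ F, ‖x‖ ≤ R) (hP : ∀ x, ∃! p, p ∈ P ∧ x - p ∈ F) :
    ((P ∩ Metric.ball 0 r).encard : ℝ≥0∞) * volume F ≤ volume (Metric.ball (0 : Plane) (r + R)) := by
  let T : ↥(P ∩ Metric.ball 0 r) → Set Plane := fun p => (fun x => x - (p : Plane)) ⁻¹' F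
  have hvol : ∀ p, volume (T p) = volume F := fun p => by
    simpa only [T, sub_eq_add_neg] using measure_preimage_add_right volume (-(p : Plane)) F
  have hmeas : ∀ p, MeasurableSet (T p) := fun p => measurable_sub_const (p : Plane) hF
  have hdisj : Pairwise (Function.onFun Disjoint T) := by
    intro p q hpq
    refine Set.disjoint_left.2 fun x hx hx' => hpq (Subtype.ext ?_)
    exact (hP x).unique ⟨p.2.1, hx⟩ ⟨q.2.1, hx'⟩
  have h := tsum_meas_le_meas_iUnion_of_disjoint volume hmeas hdisj
  simp only [hvol, ENNReal.tsum_const] at h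
  refine h.trans (measure_mono (Set.iUnion_subset fun p x hx => ?_))
  have h₁ := p.2.2
  have h₂ := hR _ hx
  rw [mem_ball_zero_iff] at h₁ ⊢
  calc ‖x‖ = ‖(p : Plane) + (x - p)‖ := by congr 1; abel
    _ ≤ ‖(p : Plane)‖ + ‖x - p‖ := norm_add_le _ _
    _ < r + R := by linarith

/-- If the translates `p + F`, `p ∈ P`, of a bounded set `F` tile the plane, then those with `p` in
the disc of radius `r` cover a slightly smaller disc. -/
theorem volume_le_encard_mul {P F : Set Plane} {R r : ℝ} (hF : MeasurableSet F)
    (hF₀ : volume F ≠ 0) (hR : ∀ x ∈ F, ‖x‖ ≤ R) (hP : ∀ x, ∃! p, p ∈ P ∧ x - p ∈ F) :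
    volume (Metric.ball (0 : Plane) (r - R)) ≤ ((P ∩ Metric.ball 0 r).encard : ℝ≥0∞) * volume F := by
  let T : ↥(P ∩ Metric.ball 0 r) → Set Plane := fun p => (fun x => x - (p : Plane)) ⁻¹' F
  have hvol : ∀ p, volume (T p) = volume F := fun p => by
    simpa only [T, sub_eq_add_neg] using measure_preimage_add_right volume (-(p : Plane)) F
  -- The packing bound gives finiteness, hence the countability needed for subadditivity of the
  -- measure.
  have hfin : (P ∩ Metric.ball 0 r).Finite := by
    rw [← Set.encard_ne_top_iff]
    intro htop
    have h := encard_mul_volume_le (r := r) hF hR hP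
    rw [htop, ENat.toENNReal_top, ENNReal.top_mul hF₀, top_le_iff] at h
    exact measure_ball_lt_top.ne h
  have : Countable ↥(P ∩ Metric.ball 0 r) := hfin.countable.to_subtype
  calc volume (Metric.ball (0 : Plane) (r - R)) ≤ volume (⋃ p, T p) := by
        refine measure_mono fun x hx => ?_
        obtain ⟨p, ⟨hp, hpF⟩, -⟩ := hP x
        refine Set.mem_iUnion.2 ⟨⟨p, hp, ?_⟩, hpF⟩
        have h₂ := hR _ hpF
        rw [mem_ball_zero_iff] at hx ⊢
        calc ‖p‖ = ‖x - (x - p)‖ := by congr 1; abel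
          _ ≤ ‖x‖ + ‖x - p‖ := norm_sub_le _ _
          _ < r := by linarith
    _ ≤ ∑' p, volume (T p) := measure_iUnion_le T
    _ = _ := by simp only [hvol, ENNReal.tsum_const]; rfl

/-- A point set whose translates of `F` tile the plane has density `1 / Area(F)`. -/
theorem hasDensity_of_tiling {P F : Set Plane} {R : ℝ} (hF : MeasurableSet F)
    (hF₀ : volume F ≠ 0) (hR : ∀ x ∈ F, ‖x‖ ≤ R) (hP : ∀ x, ∃! p, p ∈ P ∧ x - p ∈ F) :
    HasDensity P (1 / volume F) := by
  have hF' : volume F ≠ ∞ := by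
    refine ((measure_mono fun x hx => ?_).trans_lt
      (measure_closedBall_lt_top (x := (0 : Plane)) (r := R))).ne
    simpa using hR x hx
  have hlim : ∀ R : ℝ, Tendsto (fun r : ℝ => ENNReal.ofReal (((r + R) / r) ^ 2) / volume F) atTop
      (𝓝 (1 / volume F)) := fun R =>
    ENNReal.Tendsto.div_const (tendsto_ofReal_add_div_sq R) (Or.inl one_ne_zero)
  refine tendsto_of_tendsto_of_tendsto_of_le_of_le' (hlim (-R)) (hlim R) ?_ ?_
  · filter_upwards [eventually_gt_atTop 0, eventually_ge_atTop R] with r hr hrR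
    rw [← volume_ball_div_volume_ball hr (by linarith), ← sub_eq_add_neg, densityOver,
      ENNReal.div_right_comm]
    gcongr
    rw [ENNReal.div_le_iff hF₀ hF']
    exact volume_le_encard_mul hF hF₀ hR hP
  · filter_upwards [eventually_gt_atTop 0, eventually_ge_atTop (-R)] with r hr hrR
    rw [← volume_ball_div_volume_ball hr (by linarith), densityOver, ENNReal.div_right_comm]
    gcongr
    rw [ENNReal.le_div_iff_mul_le (Or.inl hF₀) (Or.inl hF')]
    exact encard_mul_volume_le hF hR hP

theorem HasDensity.upperDensity_eq {P : Set Plane} {d : ℝ≥0∞} (h : HasDensity P d) :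
    upperDensity P = d :=
  Tendsto.limsup_eq h

/-- The density of a lattice is the reciprocal of its covolume. -/
theorem IsLattice.hasDensity {Λ : Submodule ℤ Plane} (h : IsLattice Λ) :
    HasDensity (Λ : Set Plane) (1 / ENNReal.ofReal (ZLattice.covolume Λ)) := by
  obtain ⟨_, _⟩ := h
  have := ZLattice.module_free ℝ Λ
  have := ZLattice.module_finite ℝ Λ
  let b := (Module.Free.chooseBasis ℤ Λ).ofZLatticeBasis ℝ Λ
  have hspan : Submodule.span ℤ (Set.range b) = Λ :=
    (Module.Free.chooseBasis ℤ Λ).ofZLatticeBasis_span ℝ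
  obtain ⟨R, hR⟩ := (ZSpan.fundamentalDomain_isBounded b).exists_norm_le
  have hvol : volume (ZSpan.fundamentalDomain b) = ENNReal.ofReal (ZLattice.covolume Λ) := by
    rw [ZLattice.covolume_eq_measure_fundamentalDomain Λ volume
      (ZLattice.isAddFundamentalDomain (Module.Free.chooseBasis ℤ Λ) volume)]
    exact (ENNReal.ofReal_toReal
      (ZSpan.fundamentalDomain_isBounded b).measure_lt_top.ne).symm
  rw [← hvol]
  refine hasDensity_of_tiling (ZSpan.fundamentalDomain_measurableSet b) ?_ hR fun x => ?_
  · rw [hvol]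
    simpa using ZLattice.covolume_pos Λ volume
  · obtain ⟨v, hv, huniq⟩ := ZSpan.exist_unique_vadd_mem_fundamentalDomain b x
    have hmem : ∀ y : Plane, y ∈ Submodule.span ℤ (Set.range b) ↔ y ∈ Λ := fun y => by rw [hspan]
    refine ⟨-(v : Plane), ⟨neg_mem ((hmem _).1 v.2), ?_⟩, fun p hp => ?_⟩
    · rw [sub_neg_eq_add, add_comm]
      exact hv
    · have := huniq ⟨-p, (hmem _).2 (neg_mem hp.1)⟩ (by
        change -p + x ∈ _
        rw [neg_add_eq_sub]
        exact hp.2)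
      rw [← this, neg_neg]

/-! ### Generating pairs of a lattice. -/

/-- Two vectors which generate the lattice `Λ` over `ℤ`, given by their coordinates. -/
structure IsGenPair (Λ : Submodule ℤ Plane) (x₁ y₁ x₂ y₂ : ℝ) : Prop where
  mem_left : !₂[x₁, y₁] ∈ Λ
  mem_right : !₂[x₂, y₂] ∈ Λ
  exists_coeff : ∀ z ∈ Λ, ∃ m n : ℤ, z 0 = m * x₁ + n * x₂ ∧ z 1 = m * y₁ + n * y₂
  abs_det : |x₁ * y₂ - y₁ * x₂| = ZLattice.covolume Λ

namespace IsGenPair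

variable {Λ : Submodule ℤ Plane} {x₁ y₁ x₂ y₂ : ℝ}

theorem neg_left (h : IsGenPair Λ x₁ y₁ x₂ y₂) : IsGenPair Λ (-x₁) (-y₁) x₂ y₂ where
  mem_left := by
    convert neg_mem h.mem_left using 1
    ext i; fin_cases i <;> simp
  mem_right := h.mem_right
  exists_coeff z hz := by
    obtain ⟨m, n, h₀, h₁⟩ := h.exists_coeff z hz
    refine ⟨-m, n, ?_, ?_⟩ <;> push_cast <;> linarith
  abs_det := by rw [← h.abs_det, ← abs_neg]; congr 1; ring

theorem swap (h : IsGenPair Λ x₁ y₁ x₂ y₂) : IsGenPair Λ x₂ y₂ x₁ y₁ where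
  mem_left := h.mem_right
  mem_right := h.mem_left
  exists_coeff z hz := by
    obtain ⟨m, n, h₀, h₁⟩ := h.exists_coeff z hz
    exact ⟨n, m, by linarith, by linarith⟩
  abs_det := by rw [← h.abs_det, ← abs_neg]; congr 1; ring

theorem add_right (h : IsGenPair Λ x₁ y₁ x₂ y₂) : IsGenPair Λ x₁ y₁ (x₂ + x₁) (y₂ + y₁) where
  mem_left := h.mem_left
  mem_right := by
    convert add_mem h.mem_right h.mem_left using 1
    ext i; fin_cases i <;> simp
  exists_coeff z hz := by
    obtain ⟨m, n, h₀, h₁⟩ := h.exists_coeff z hz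
    refine ⟨m - n, n, ?_, ?_⟩ <;> push_cast <;> linarith
  abs_det := by rw [← h.abs_det]; congr 1; ring

theorem neg_right (h : IsGenPair Λ x₁ y₁ x₂ y₂) : IsGenPair Λ x₁ y₁ (-x₂) (-y₂) :=
  h.swap.neg_left.swap

theorem sub_right (h : IsGenPair Λ x₁ y₁ x₂ y₂) : IsGenPair Λ x₁ y₁ (x₂ - x₁) (y₂ - y₁) := by
  simpa [sub_eq_add_neg] using h.neg_left.add_right.neg_left

theorem add_left (h : IsGenPair Λ x₁ y₁ x₂ y₂) : IsGenPair Λ (x₁ + x₂) (y₁ + y₂) x₂ y₂ :=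
  h.swap.add_right.swap

theorem sub_left (h : IsGenPair Λ x₁ y₁ x₂ y₂) : IsGenPair Λ (x₁ - x₂) (y₁ - y₂) x₂ y₂ :=
  h.swap.sub_right.swap

end IsGenPair

theorem norm_le_abs_add_abs (x y : ℝ) : ‖(!₂[x, y] : Plane)‖ ≤ |x| + |y| := by
  rw [EuclideanSpace.norm_eq, Fin.sum_univ_two]
  refine Real.sqrt_le_iff.2 ⟨by positivity, ?_⟩
  simp only [Matrix.cons_val_zero, Matrix.cons_val_one, Real.norm_eq_abs]
  nlinarith [mul_nonneg (abs_nonneg x) (abs_nonneg y)]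

theorem IsLattice.exists_isGenPair {Λ : Submodule ℤ Plane} (h : IsLattice Λ) :
    ∃ x₁ y₁ x₂ y₂, IsGenPair Λ x₁ y₁ x₂ y₂ := by
  obtain ⟨_, _⟩ := h
  have := ZLattice.module_free ℝ Λ
  have := ZLattice.module_finite ℝ Λ
  let b : Module.Basis (Fin 2) ℤ Λ := (Module.Free.chooseBasis ℤ Λ).reindex
    (Fintype.equivOfCardEq (by
      rw [← Module.finrank_eq_card_chooseBasisIndex, ZLattice.rank ℝ]; simp))
  let e := EuclideanSpace.basisFun (Fin 2) ℝ
  have heta : ∀ z : Plane, !₂[z 0, z 1] = z := fun z => by ext i; fin_cases i <;> simp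
  refine ⟨(b 0 : Plane) 0, (b 0 : Plane) 1, (b 1 : Plane) 0, (b 1 : Plane) 1, ?_, ?_, ?_, ?_⟩
  · rw [heta]; exact (b 0).2
  · rw [heta]; exact (b 1).2
  · intro z hz
    have hz' := congrArg (Subtype.val) (b.sum_repr ⟨z, hz⟩)
    simp only [Fin.sum_univ_two, Submodule.coe_add, Submodule.coe_smul] at hz'
    refine ⟨b.repr ⟨z, hz⟩ 0, b.repr ⟨z, hz⟩ 1, ?_, ?_⟩ <;>
    · conv_lhs => rw [← hz']
      simp
  · have hvol : volume.real (ZSpan.fundamentalDomain e.toBasis) = 1 := by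
      rw [measureReal_congr (ZSpan.fundamentalDomain_ae_parallelepiped e.toBasis volume),
        Measure.real, OrthonormalBasis.coe_toBasis, e.volume_parallelepiped, ENNReal.toReal_one]
    rw [ZLattice.covolume_eq_det_mul_measureReal Λ volume b e.toBasis, hvol, mul_one,
      Module.Basis.det_apply, Matrix.det_fin_two]
    congr 1
    simp [Module.Basis.toMatrix_apply, e]
    ring

/-- Only finitely many generating pairs have bounded coordinates. -/
theorem IsLattice.finite_isGenPair {Λ : Submodule ℤ Plane} (h : IsLattice Λ) (C : ℝ) :
    {x : ℝ × ℝ × ℝ × ℝ | IsGenPair Λ x.1 x.2.1 x.2.2.1 x.2.2.2 ∧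
      |x.1| + |x.2.1| + |x.2.2.1| + |x.2.2.2| ≤ C}.Finite := by
  obtain ⟨_, _⟩ := h
  have hfin : ((Λ : Set Plane) ∩ Metric.closedBall 0 C).Finite := by
    refine Set.inter_comm _ _ ▸ Metric.finite_isBounded_inter_isClosed DiscreteTopology.isDiscrete
      Metric.isBounded_closedBall ?_
    exact inferInstanceAs (IsClosed (Λ.toAddSubgroup : Set Plane))
  refine ((hfin.prod hfin).image fun p => (p.1 0, p.1 1, p.2 0, p.2 1)).subset ?_
  rintro ⟨x₁, y₁, x₂, y₂⟩ ⟨hx, hC⟩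
  dsimp only at hx hC
  refine ⟨(!₂[x₁, y₁], !₂[x₂, y₂]), ⟨⟨hx.mem_left, ?_⟩, ⟨hx.mem_right, ?_⟩⟩, by simp⟩
  · have := norm_le_abs_add_abs x₁ y₁
    have := abs_nonneg x₂
    have := abs_nonneg y₂
    simp only [mem_closedBall_zero_iff]
    linarith
  · have := norm_le_abs_add_abs x₂ y₂
    have := abs_nonneg x₁
    have := abs_nonneg y₁
    simp only [mem_closedBall_zero_iff]
    linarith

/-! ### Quadrant bases and their empty boxes. -/

/-- A basis `(a, b)`, `(-c, d)` of `Λ` with one vector in each of the upper two quadrants. -/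
def IsQuadrantBasis (Λ : Submodule ℤ Plane) (a b c d : ℝ) : Prop :=
  (0 ≤ a ∧ 0 ≤ b ∧ 0 ≤ c ∧ 0 ≤ d) ∧ IsGenPair Λ a b (-c) d

/-- Sign changes put both vectors in the right half-plane. If their heights have opposite signs, one
more sign change suffices. Otherwise compare absolute coordinates: if neither vector dominates the
other, their difference up to sign lies in the missing quadrant; if one dominates, subtracting the
other shortens it, so minimality makes the smaller vector zero. -/
theorem IsGenPair.exists_isQuadrantBasis_of_minimal {Λ : Submodule ℤ Plane} {x₁ y₁ x₂ y₂ : ℝ}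
    (h : IsGenPair Λ x₁ y₁ x₂ y₂)
    (hmin : ∀ x₁' y₁' x₂' y₂', IsGenPair Λ x₁' y₁' x₂' y₂' →
      |x₁| + |y₁| + |x₂| + |y₂| ≤ |x₁'| + |y₁'| + |x₂'| + |y₂'|) :
    ∃ a b c d, IsQuadrantBasis Λ a b c d := by
  wlog hx₁ : 0 ≤ x₁ generalizing x₁ y₁
  · exact this h.neg_left (by simpa using hmin) (by linarith)
  wlog hx₂ : 0 ≤ x₂ generalizing x₂ y₂
  · exact this h.neg_right (by simpa using hmin) (by linarith)
  have mk : ∀ {x y z w}, IsGenPair Λ x y z w → 0 ≤ x → 0 ≤ y → z ≤ 0 → 0 ≤ w →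
      ∃ a b c d, IsQuadrantBasis Λ a b c d := fun {x y z w} h hx hy hz hw =>
    ⟨x, y, -z, w, ⟨hx, hy, by linarith, hw⟩, by simpa using h⟩
  rcases le_total 0 y₁ with hy₁ | hy₁ <;> rcases le_total 0 y₂ with hy₂ | hy₂
  · rcases le_total x₁ x₂ with hx | hx <;> rcases le_total y₁ y₂ with hy | hy
    · have := hmin _ _ _ _ h.sub_right
      rw [abs_of_nonneg hx₁, abs_of_nonneg hx₂, abs_of_nonneg hy₁, abs_of_nonneg hy₂,
        abs_of_nonneg (sub_nonneg.2 hx), abs_of_nonneg (sub_nonneg.2 hy)] at this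
      obtain rfl : x₁ = 0 := by linarith
      obtain rfl : y₁ = 0 := by linarith
      simpa using mk h.swap hx₂ hy₂ le_rfl le_rfl
    · exact mk h.sub_right.neg_right hx₁ hy₁ (by linarith) (by linarith)
    · exact mk h.swap.sub_right.neg_right hx₂ hy₂ (by linarith) (by linarith)
    · have := hmin _ _ _ _ h.sub_left
      rw [abs_of_nonneg hx₁, abs_of_nonneg hx₂, abs_of_nonneg hy₁, abs_of_nonneg hy₂,
        abs_of_nonneg (sub_nonneg.2 hx), abs_of_nonneg (sub_nonneg.2 hy)] at this
      obtain rfl : x₂ = 0 := by linarith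
      obtain rfl : y₂ = 0 := by linarith
      simpa using mk h hx₁ hy₁ le_rfl le_rfl
  · exact mk h.neg_right hx₁ hy₁ (by linarith) (by linarith)
  · exact mk h.swap.neg_right hx₂ hy₂ (by linarith) (by linarith)
  · rcases le_total x₁ x₂ with hx | hx <;> rcases le_total y₁ y₂ with hy | hy
    · exact mk h.sub_right.neg_left.swap (by linarith) (by linarith) (by linarith) (by linarith)
    · have := hmin _ _ _ _ h.sub_right
      rw [abs_of_nonneg hx₁, abs_of_nonneg hx₂, abs_of_nonpos hy₁, abs_of_nonpos hy₂,
        abs_of_nonneg (sub_nonneg.2 hx), abs_of_nonpos (sub_nonpos.2 hy)] at this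
      obtain rfl : x₁ = 0 := by linarith
      obtain rfl : y₁ = 0 := by linarith
      exact mk h.neg_right le_rfl le_rfl (by linarith) (by linarith)
    · have := hmin _ _ _ _ h.sub_left
      rw [abs_of_nonneg hx₁, abs_of_nonneg hx₂, abs_of_nonpos hy₁, abs_of_nonpos hy₂,
        abs_of_nonneg (sub_nonneg.2 hx), abs_of_nonpos (sub_nonpos.2 hy)] at this
      obtain rfl : x₂ = 0 := by linarith
      obtain rfl : y₂ = 0 := by linarith
      exact mk h.swap.neg_right le_rfl le_rfl (by linarith) (by linarith)
    · exact mk h.sub_left.neg_right (by linarith) (by linarith) (by linarith)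
        (by linarith)

theorem IsLattice.exists_isQuadrantBasis {Λ : Submodule ℤ Plane} (h : IsLattice Λ) :
    ∃ a b c d, IsQuadrantBasis Λ a b c d := by
  obtain ⟨x₁, y₁, x₂, y₂, hx⟩ := h.exists_isGenPair
  obtain ⟨x, hx', hmin⟩ := Set.exists_min_image _
    (fun x : ℝ × ℝ × ℝ × ℝ => |x.1| + |x.2.1| + |x.2.2.1| + |x.2.2.2|)
    (h.finite_isGenPair (|x₁| + |y₁| + |x₂| + |y₂|)) ⟨(x₁, y₁, x₂, y₂), hx, le_rfl⟩
  refine hx'.1.exists_isQuadrantBasis_of_minimal fun x₁' y₁' x₂' y₂' h' => ?_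
  by_cases hle : |x₁'| + |y₁'| + |x₂'| + |y₂'| ≤ |x₁| + |y₁| + |x₂| + |y₂|
  · exact hmin (x₁', y₁', x₂', y₂') ⟨h', hle⟩
  · exact hx'.2.trans (not_le.1 hle).le

/-- The open box spanned by a quadrant basis contains no lattice point. -/
theorem IsQuadrantBasis.box_empty {Λ : Submodule ℤ Plane} {a b c d : ℝ}
    (h : IsQuadrantBasis Λ a b c d) {z : Plane} (hz : z ∈ Λ) (h₁ : -c < z 0) (h₂ : z 0 < a)
    (h₃ : 0 < z 1) (h₄ : z 1 < b + d) : False := by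
  obtain ⟨⟨ha, hb, hc, hd⟩, h⟩ := h
  obtain ⟨m, n, h0, h1⟩ := h.exists_coeff z hz
  -- Coefficients of equal sign type violate a vertical bound, those of different type a horizontal
  -- one.
  have hint : ∀ k : ℤ, (1 : ℝ) ≤ k ∨ (k : ℝ) ≤ 0 := fun k => by
    rcases lt_or_ge 0 k with hk | hk
    · exact Or.inl (by exact_mod_cast hk)
    · exact Or.inr (by exact_mod_cast hk)
  rcases hint m with hm' | hm' <;> rcases hint n with hn' | hn'
  · linarith [sub_mul_sub_nonneg hm' hb, sub_mul_sub_nonneg hn' hd]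
  · linarith [sub_mul_sub_nonneg hm' ha, sub_mul_sub_nonneg hn' hc]
  · linarith [sub_mul_sub_nonneg hm' ha, sub_mul_sub_nonneg hn' hc]
  · linarith [sub_mul_sub_nonneg hm' hb, sub_mul_sub_nonneg hn' hd]

theorem IsQuadrantBasis.width_le_or_height_le {Λ : Submodule ℤ Plane} {a b c d w k : ℝ}
    (h : IsQuadrantBasis Λ a b c d) (hp : ∀ p, ((Λ : Set Plane) ∩ rect w k p).Nonempty) :
    a + c ≤ w ∨ b + d ≤ k := by
  by_contra! hcon
  -- The corner that centres the closed `w × k` rectangle in the strictly larger open box.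
  obtain ⟨z, hz, ⟨h₁, h₂⟩, h₃, h₄⟩ := hp !₂[-c + (a + c - w) / 2, (b + d - k) / 2]
  simp only [Matrix.cons_val_zero, Matrix.cons_val_one] at h₁ h₂ h₃ h₄
  refine h.box_empty hz ?_ ?_ ?_ ?_ <;> linarith

theorem staircaseFamily {Λ : Submodule ℤ Plane} (h : IsLattice Λ)
    (hp : Pierces (Λ : Set Plane) threeRects) :
    StaircaseFamily (IsQuadrantBasis Λ) (ZLattice.covolume Λ) where
  nonneg h := h.1
  area := by
    rintro a b c d ⟨⟨ha, hb, hc, hd⟩, h⟩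
    rw [← h.abs_det, abs_of_nonneg (by nlinarith [mul_nonneg ha hd, mul_nonneg hb hc])]
    ring
  area_pos := by
    obtain ⟨_, _⟩ := h
    exact ZLattice.covolume_pos Λ volume
  fwd_left := by
    rintro a b c d ⟨⟨ha, hb, hc, hd⟩, h⟩ hac
    refine ⟨⟨ha, hb, by linarith, by linarith⟩, ?_⟩
    convert h.add_right using 1 <;> ring
  fwd_right := by
    rintro a b c d ⟨⟨ha, hb, hc, hd⟩, h⟩ hac
    refine ⟨⟨by linarith, by linarith, hc, hd⟩, ?_⟩
    convert h.add_left using 1; ring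
  bwd_left := by
    rintro a b c d ⟨⟨ha, hb, hc, hd⟩, h⟩ hac
    refine ⟨⟨ha, hb, by linarith, by linarith⟩, ?_⟩
    convert h.sub_right using 1; ring
  bwd_right := by
    rintro a b c d ⟨⟨ha, hb, hc, hd⟩, h⟩ hac
    refine ⟨⟨by linarith, by linarith, hc, hd⟩, ?_⟩
    convert h.sub_left using 1; ring
  flat_or_le_six h := (h.width_le_or_height_le (hp (6, 1) (by simp [threeRects]))).symm
  le_three h := h.width_le_or_height_le (hp (3, 3) (by simp [threeRects]))
  thin_or_le_six h := h.width_le_or_height_le (hp (1, 6) (by simp [threeRects]))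
  finite C := by
    refine ((h.finite_isGenPair (C + C)).image
      fun x => (x.1, x.2.1, -x.2.2.1, x.2.2.2)).subset ?_
    rintro ⟨a, b, c, d⟩ ⟨⟨⟨ha, hb, hc, hd⟩, hq⟩, h₁, h₂⟩
    refine ⟨(a, b, -c, d), ⟨hq, ?_⟩, by simp⟩
    dsimp only at *
    rw [abs_neg, abs_of_nonneg ha, abs_of_nonneg hb, abs_of_nonneg hc, abs_of_nonneg hd]
    linarith

/-- A lattice that pierces all three rectangles has covolume at most `31 / 6`. -/
theorem covolume_le {Λ : Submodule ℤ Plane} (h : IsLattice Λ)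
    (hp : Pierces (Λ : Set Plane) threeRects) : ZLattice.covolume Λ ≤ 31 / 6 := by
  obtain ⟨a, b, c, d, hq⟩ := h.exists_isQuadrantBasis
  exact (staircaseFamily h hp).area_le hq

/-! ### The periodic piercing set. -/

/-- The integer points `(x, y)` with `x ≡ σ y` modulo `6`, where `σ` is the `6`-periodic function
with the values `0, 2, 4, 1, 3, 5`. -/
def shearedPoints : Set Plane :=
  {p | ∃ x y : ℤ, p 0 = x ∧ p 1 = y ∧ 6 ∣ x - 2 * y - y % 6 / 3}

theorem mem_shearedPoints {x y : ℤ} :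
    !₂[(x : ℝ), (y : ℝ)] ∈ shearedPoints ↔ 6 ∣ x - 2 * y - y % 6 / 3 := by
  constructor
  · rintro ⟨x', y', hx, hy, h⟩
    simp only [Matrix.cons_val_zero, Matrix.cons_val_one, Int.cast_inj] at hx hy
    rwa [hx, hy]
  · exact fun h => ⟨x, y, by simp, by simp, h⟩

theorem exists_in_row (X Y : ℤ) : ∃ x, X ≤ x ∧ x ≤ X + 5 ∧ 6 ∣ x - 2 * Y - Y % 6 / 3 :=
  ⟨X + (2 * Y + Y % 6 / 3 - X) % 6, by omega, by omega, by omega⟩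

/-- Periodicity modulo `6` in both coordinates reduces the column and square conditions to finite
checks by `decide`. -/
theorem six_dvd_add_mul (x y m n : ℤ) :
    6 ∣ (x + 6 * m) - 2 * (y + 6 * n) - (y + 6 * n) % 6 / 3 ↔ 6 ∣ x - 2 * y - y % 6 / 3 := by
  rw [Int.add_mul_emod_self_left]
  omega

theorem exists_eq_fin_add_six_mul (X : ℤ) : ∃ (i : Fin 6) (m : ℤ), X = (i : ℕ) + 6 * m :=
  ⟨⟨(X % 6).toNat, by omega⟩, X / 6, by dsimp only; omega⟩

theorem exists_in_column (X Y : ℤ) : ∃ y, Y ≤ y ∧ y ≤ Y + 5 ∧ 6 ∣ X - 2 * y - y % 6 / 3 := by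
  have key : ∀ i j : Fin 6, ∃ l : Fin 6,
      (6 : ℤ) ∣ (i : ℕ) - 2 * ((j : ℕ) + (l : ℕ)) - ((j : ℕ) + (l : ℕ)) % 6 / 3 := by decide
  obtain ⟨i, m, rfl⟩ := exists_eq_fin_add_six_mul X
  obtain ⟨j, n, rfl⟩ := exists_eq_fin_add_six_mul Y
  obtain ⟨l, h⟩ := key i j
  refine ⟨(j : ℕ) + (l : ℕ) + 6 * n, by omega, by omega, ?_⟩
  rwa [six_dvd_add_mul]

theorem exists_in_square (X Y : ℤ) : ∃ x y, X ≤ x ∧ x ≤ X + 2 ∧ Y ≤ y ∧ y ≤ Y + 2 ∧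
    6 ∣ x - 2 * y - y % 6 / 3 := by
  have key : ∀ i j : Fin 6, ∃ k l : Fin 3, (6 : ℤ) ∣
      ((i : ℕ) + (k : ℕ)) - 2 * ((j : ℕ) + (l : ℕ)) - ((j : ℕ) + (l : ℕ)) % 6 / 3 := by decide
  obtain ⟨i, m, rfl⟩ := exists_eq_fin_add_six_mul X
  obtain ⟨j, n, rfl⟩ := exists_eq_fin_add_six_mul Y
  obtain ⟨k, l, h⟩ := key i j
  refine ⟨(i : ℕ) + (k : ℕ) + 6 * m, (j : ℕ) + (l : ℕ) + 6 * n, by omega, by omega, by omega,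
    by omega, ?_⟩
  rwa [six_dvd_add_mul]

/-- An interval of length at least `m + 1` contains the `m + 1` consecutive integers starting at the
ceiling of its left end. -/
theorem pierces_of_integer_points {P : Set Plane} {w h : ℝ} {m n : ℤ} (hw : (m : ℝ) + 1 ≤ w)
    (hh : (n : ℝ) + 1 ≤ h) (hP : ∀ X Y : ℤ, ∃ x y : ℤ, X ≤ x ∧ x ≤ X + m ∧ Y ≤ y ∧ y ≤ Y + n ∧
      !₂[(x : ℝ), (y : ℝ)] ∈ P) (p : Plane) : (P ∩ rect w h p).Nonempty := by
  obtain ⟨x, y, h₁, h₂, h₃, h₄, hxy⟩ := hP ⌈p 0⌉ ⌈p 1⌉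
  have h₂' : (x : ℝ) ≤ ⌈p 0⌉ + m := by exact_mod_cast h₂
  have h₄' : (y : ℝ) ≤ ⌈p 1⌉ + n := by exact_mod_cast h₄
  have := Int.ceil_lt_add_one (p 0)
  have := Int.ceil_lt_add_one (p 1)
  refine ⟨_, hxy, ⟨?_, ?_⟩, ?_, ?_⟩ <;>
    simp only [Matrix.cons_val_zero, Matrix.cons_val_one]
  · exact Int.ceil_le.1 h₁
  · linarith
  · exact Int.ceil_le.1 h₃
  · linarith

theorem pierces_shearedPoints : Pierces shearedPoints threeRects := by
  rintro ⟨w, h⟩ hR p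
  simp only [threeRects, Set.mem_insert_iff, Set.mem_singleton_iff, Prod.mk.injEq] at hR
  rcases hR with ⟨rfl, rfl⟩ | ⟨rfl, rfl⟩ | ⟨rfl, rfl⟩
  · refine pierces_of_integer_points (m := 5) (n := 0) (by norm_num) (by norm_num)
      (fun X Y => ?_) p
    obtain ⟨x, h₁, h₂, h⟩ := exists_in_row X Y
    exact ⟨x, Y, h₁, h₂, le_rfl, by simp, mem_shearedPoints.2 h⟩
  · refine pierces_of_integer_points (m := 0) (n := 5) (by norm_num) (by norm_num)
      (fun X Y => ?_) p
    obtain ⟨y, h₁, h₂, h⟩ := exists_in_column X Y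
    exact ⟨X, y, le_rfl, by simp, h₁, h₂, mem_shearedPoints.2 h⟩
  · refine pierces_of_integer_points (m := 2) (n := 2) (by norm_num) (by norm_num)
      (fun X Y => ?_) p
    obtain ⟨x, y, h₁, h₂, h₃, h₄, h⟩ := exists_in_square X Y
    exact ⟨x, y, h₁, h₂, h₃, h₄, mem_shearedPoints.2 h⟩

theorem isPeriodic_shearedPoints : IsPeriodic shearedPoints := by
  let b : Module.Basis (Fin 2) ℝ Plane :=
    (EuclideanSpace.basisFun (Fin 2) ℝ).toBasis.isUnitSMul (w := fun _ => 6)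
      fun _ => (by norm_num : (6 : ℝ) ≠ 0).isUnit
  refine ⟨Submodule.span ℤ (Set.range b), ⟨inferInstance, inferInstance⟩, ?_⟩
  have hb : ∀ i, b i = (6 : ℝ) • EuclideanSpace.basisFun (Fin 2) ℝ i := fun i => by
    simp [b, Module.Basis.isUnitSMul_apply]
  have hspan : ∀ t ∈ Submodule.span ℤ (Set.range b),
      ∃ m n : ℤ, t 0 = 6 * m ∧ t 1 = 6 * n := by
    intro t ht
    induction ht using Submodule.span_induction with
    | mem t ht =>
      obtain ⟨i, rfl⟩ := ht
      fin_cases i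
      · exact ⟨1, 0, by simp [hb], by simp [hb]⟩
      · exact ⟨0, 1, by simp [hb], by simp [hb]⟩
    | zero => exact ⟨0, 0, by simp, by simp⟩
    | add s t _ _ hs ht =>
      obtain ⟨m, n, h₁, h₂⟩ := hs
      obtain ⟨m', n', h₁', h₂'⟩ := ht
      exact ⟨m + m', n + n', by simp [h₁, h₁']; ring, by simp [h₂, h₂']; ring⟩
    | smul k t _ ht =>
      obtain ⟨m, n, h₁, h₂⟩ := ht
      exact ⟨k * m, k * n, by simp [h₁]; ring, by simp [h₂]; ring⟩
  rintro t ht p ⟨x, y, hx, hy, h⟩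
  obtain ⟨m, n, h₁, h₂⟩ := hspan t ht
  refine ⟨6 * m + x, 6 * n + y, ?_, ?_, by omega⟩
  · simp [h₁, hx]
  · simp [h₂, hy]

/-- A lattice translate through `(0, 0)` and `(2, 1)` also contains `(6, 3)`, but the shear jumps by
an extra unit at row `3`. -/
theorem not_isLatticeTranslate_shearedPoints : ¬ IsLatticeTranslate shearedPoints := by
  rintro ⟨Λ, t, -, hΛ⟩
  have h₀ : !₂[((0 : ℤ) : ℝ), ((0 : ℤ) : ℝ)] ∈ shearedPoints := mem_shearedPoints.2 (by norm_num)
  have h₁ : !₂[((2 : ℤ) : ℝ), ((1 : ℤ) : ℝ)] ∈ shearedPoints := mem_shearedPoints.2 (by norm_num)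
  have h₃ : !₂[((6 : ℤ) : ℝ), ((3 : ℤ) : ℝ)] ∉ shearedPoints := fun h => by
    have := mem_shearedPoints.1 h
    omega
  rw [hΛ] at h₀ h₁ h₃
  obtain ⟨u, hu, hu'⟩ := h₀
  obtain ⟨v, hv, hv'⟩ := h₁
  refine h₃ ⟨(3 : ℤ) • (v - u) + u, add_mem (Λ.smul_mem 3 (sub_mem hv hu)) hu, ?_⟩
  obtain rfl : v = !₂[((2 : ℤ) : ℝ), ((1 : ℤ) : ℝ)] - t := eq_sub_of_add_eq' hv'
  obtain rfl : u = !₂[((0 : ℤ) : ℝ), ((0 : ℤ) : ℝ)] - t := eq_sub_of_add_eq' hu'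
  ext i
  fin_cases i <;> norm_num

/-! ### Density of the periodic set and the final comparison. -/

/-- The half-open `6 × 1` rectangle at the origin. -/
def halfOpenRect : Set Plane := {z | z 0 ∈ Set.Ico 0 6 ∧ z 1 ∈ Set.Ico 0 1}

theorem halfOpenRect_eq_preimage : halfOpenRect =
    (MeasurableEquiv.toLp 2 (Fin 2 → ℝ)).symm ⁻¹' Set.pi Set.univ fun i => Set.Ico 0 (![6, 1] i) := by
  ext z
  simp [halfOpenRect, Fin.forall_fin_two]

theorem measurableSet_halfOpenRect : MeasurableSet halfOpenRect := by
  rw [halfOpenRect_eq_preimage]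
  exact (MeasurableEquiv.measurable _) (MeasurableSet.univ_pi fun _ => measurableSet_Ico)

theorem volume_halfOpenRect : volume halfOpenRect = 6 := by
  rw [halfOpenRect_eq_preimage,
    (EuclideanSpace.volume_preserving_symm_measurableEquiv_toLp (Fin 2)).measure_preimage
      (MeasurableSet.univ_pi fun _ => measurableSet_Ico).nullMeasurableSet]
  rw [show (fun i => Set.Ico (0 : ℝ) (![6, 1] i)) = fun i => Set.Ico ((0 : Fin 2 → ℝ) i) (![6, 1] i)
    from rfl, Real.volume_pi_Ico]
  simp

/-- Each integer row carries exactly one residue class modulo `6`, so half-open `6 × 1` tiles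
attached to its points fill the strip above that row. -/
theorem existsUnique_shearedPoints (z : Plane) :
    ∃! p, p ∈ shearedPoints ∧ z - p ∈ halfOpenRect := by
  have hfloor : ∀ (t : ℝ) (k : ℤ) (n : ℤ), t - k ∈ Set.Ico (0 : ℝ) n ↔ k ≤ ⌊t⌋ ∧ ⌊t⌋ < k + n := by
    intro t k n
    rw [Set.mem_Ico, sub_nonneg, Int.le_floor, Int.floor_lt, sub_lt_iff_lt_add']
    push_cast
    rfl
  have hmem : ∀ {p : Plane} {x y : ℤ}, p 0 = x → p 1 = y → (z - p ∈ halfOpenRect ↔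
      (x ≤ ⌊z 0⌋ ∧ ⌊z 0⌋ < x + 6) ∧ y ≤ ⌊z 1⌋ ∧ ⌊z 1⌋ < y + 1) := by
    intro p x y hx hy
    rw [← hfloor, ← hfloor]
    simp [halfOpenRect, hx, hy]
  set X := ⌊z 0⌋
  set Y := ⌊z 1⌋
  refine ⟨!₂[((X - (X - 2 * Y - Y % 6 / 3) % 6 : ℤ) : ℝ), (Y : ℝ)],
    ⟨mem_shearedPoints.2 (by omega), (hmem rfl rfl).2 (by omega)⟩, ?_⟩
  rintro p ⟨⟨x, y, hx, hy, h⟩, hp⟩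
  rw [hmem hx hy] at hp
  obtain rfl : y = Y := by omega
  obtain rfl : x = X - (X - 2 * Y - Y % 6 / 3) % 6 := by omega
  ext i
  fin_cases i
  · exact hx
  · exact hy

theorem hasDensity_shearedPoints : HasDensity shearedPoints (1 / 6) := by
  rw [← volume_halfOpenRect]
  refine hasDensity_of_tiling (R := 7) measurableSet_halfOpenRect ?_ ?_ existsUnique_shearedPoints
  · simp [volume_halfOpenRect]
  · rintro z ⟨h₀, h₁⟩
    have heta : !₂[z 0, z 1] = z := by ext i; fin_cases i <;> simp
    have := norm_le_abs_add_abs (z 0) (z 1)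
    rw [heta, abs_of_nonneg h₀.1, abs_of_nonneg h₁.1] at this
    linarith [h₀.2, h₁.2]

theorem six_div_le_upperDensity {Λ : Submodule ℤ Plane} (h : IsLattice Λ)
    (hp : Pierces (Λ : Set Plane) threeRects) : 6 / 31 ≤ upperDensity (Λ : Set Plane) := by
  have hV := covolume_le h hp
  rw [h.hasDensity.upperDensity_eq, ← ENNReal.inv_div (by simp) (by simp), one_div]
  refine ENNReal.inv_le_inv.2 ((ENNReal.ofReal_le_ofReal hV).trans_eq ?_)
  rw [ENNReal.ofReal_div_of_pos (by norm_num)]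
  norm_num

theorem mainTheorem3 :
    (∀ Λ : Submodule ℤ Plane, IsLattice Λ → Pierces (Λ : Set Plane) threeRects →
      ZLattice.covolume Λ ≤ 31 / 6) ∧
    (∃ P : Set Plane, IsPeriodic P ∧ ¬ IsLatticeTranslate P ∧ Pierces P threeRects ∧
      HasDensity P (1 / 6)) ∧
    (36 / 31 : ℝ≥0∞) * piercingDensity threeRects ≤ latticePiercingDensity threeRects := by
  refine ⟨fun Λ h hp => covolume_le h hp, ⟨shearedPoints, isPeriodic_shearedPoints,
    not_isLatticeTranslate_shearedPoints, pierces_shearedPoints, hasDensity_shearedPoints⟩, ?_⟩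
  have hπ : piercingDensity threeRects ≤ 1 / 6 :=
    (iInf₂_le shearedPoints pierces_shearedPoints).trans_eq
      hasDensity_shearedPoints.upperDensity_eq
  have hmul : (36 / 31 : ℝ≥0∞) * (1 / 6) = 6 / 31 := by
    rw [← ENNReal.toReal_eq_toReal_iff' (by finiteness) (by finiteness)]
    norm_num
  calc (36 / 31 : ℝ≥0∞) * piercingDensity threeRects ≤ 36 / 31 * (1 / 6) := by gcongr
    _ = 6 / 31 := hmul
    _ ≤ latticePiercingDensity threeRects :=
      le_iInf fun Λ => le_iInf fun h => le_iInf fun hp => six_div_le_upperDensity h hp
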